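/- Let $n \ge 0$ be an integer; all graphs are finite and simple (no loops or multiple edges). A graph $G$ is called \emph{$n$-rainbow} if its vertices can be coloured (not necessarily properly) with $n$ colours in such a way that, for every vertex $v$, each of the $n$ colours appears exactly once among the neighbours of $v$. A graph is called \emph{even} if all its vertices have even degree. Then the number of isomorphism classes of $n$-rainbow graphs on $2n$ vertices equals the number of isomorphism classes of even graphs on $n$ vertices (unlabelled even graphs). -/

import Mathlib

/-- A vertex colouring `c` of the simple graph `G` with colours `Fin n` is an `n`-rainbow colouring
if each of the `n` colours appears exactly once in the (open) neighbourhood of every vertex. -/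
def SimpleGraph.IsRainbowColoring {V : Type*} {n : ℕ} (G : SimpleGraph V) (c : V → Fin n) : Prop :=
  ∀ (v : V) (i : Fin n), ∃! w : V, G.Adj v w ∧ c w = i

/-- A graph is `n`-rainbow if it admits an `n`-rainbow colouring. -/
def SimpleGraph.IsRainbow {V : Type*} (G : SimpleGraph V) (n : ℕ) : Prop :=
  ∃ c : V → Fin n, G.IsRainbowColoring c

open Classical in
/-- A (finite) graph is even if every vertex has even degree. -/
def SimpleGraph.IsEvenGraph {V : Type*} [Fintype V] (G : SimpleGraph V) : Prop :=
  ∀ v : V, Even (G.degree v)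

/-- The isomorphism relation on graphs with vertex set `V`. -/
def SimpleGraph.isoSetoid (V : Type*) : Setoid (SimpleGraph V) where
  r G H := Nonempty (G ≃g H)
  iseqv := ⟨fun _ => ⟨SimpleGraph.Iso.refl⟩, fun ⟨e⟩ => ⟨e.symm⟩, fun ⟨e⟩ ⟨f⟩ => ⟨e.trans f⟩⟩

/-- Unlabelled graphs on `m` vertices: isomorphism classes of graphs on `m` vertices. -/
def UnlabelledGraph (m : ℕ) : Type := Quotient (SimpleGraph.isoSetoid (Fin m))

/-- The unlabelled graph underlying a labelled graph. -/
def UnlabelledGraph.mk {m : ℕ} (G : SimpleGraph (Fin m)) : UnlabelledGraph m :=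
  Quotient.mk (SimpleGraph.isoSetoid (Fin m)) G

/-- There are finitely many unlabelled graphs on `m` vertices, so `Set.ncard` genuinely counts. -/
instance UnlabelledGraph.instFinite (m : ℕ) : Finite (UnlabelledGraph m) :=
  inferInstanceAs (Finite (Quotient (SimpleGraph.isoSetoid (Fin m))))

/-!
Both numbers count orbits of the symmetric group on `n` letters, acting on a vector space over
`ZMod 2` in one case and on its dual in the other; by Burnside's lemma these numbers agree.

Let `G` be an `n`-rainbow graph on `2 * n` vertices. Every colour class consists of two adjacent
vertices, and between two colour classes the edges form a perfect matching, which can be laid in two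
ways. So `G` is the double cover of a graph on `n` vertices that records these choices
(`SimpleGraph.IsRainbow.exists_iso_doubleCover`), and exchanging the names of the two vertices in
some colour classes changes that graph by Seidel switching. The colouring is not determined by `G`,
but exchanging the two vertices of each class is an involution taking every vertex to one with the
complementary neighbourhood, and any two such involutions are conjugate under automorphisms of `G`
(`SimpleGraph.IsAntipodal.exists_iso_conj`). Hence isomorphism classes of `n`-rainbow graphs
correspond to switching classes of graphs on `n` vertices up to relabelling
(`SimpleGraph.nonempty_doubleCover_iso_iff`).

Even graphs on `n` vertices form a vector space over `ZMod 2`, the cycle space of the complete graph.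
Counting common edges modulo 2 makes every graph a linear form on it. All linear forms arise
(`SimpleGraph.edgePairing_surjective`), and two graphs give the same form exactly when they are
switching equivalent (`SimpleGraph.edgePairing_eq_iff`), so switching classes are the elements of
the dual space. Finally a finite group acting linearly on a finite vector space has as many orbits
on vectors as on linear forms, because a linear map and its transpose have the same rank, so every
group element has equally many fixed points on both (`card_orbits_dual`).
-/

/-! ### Counting orbits -/

/-- If two points have the same image under `F` exactly when their images under a surjection `L`
are equivalent, then `F` takes as many values as there are equivalence classes. -/
theorem Set.ncard_range_eq_card_quotient {A B C : Type*} {t : Setoid C} (F : A → B) (L : A → C)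
    (hL : Function.Surjective L) (h : ∀ a a', F a = F a' ↔ t (L a) (L a')) :
    (Set.range F).ncard = Nat.card (Quotient t) := by
  rw [← Nat.card_coe_set_eq]
  refine (Nat.card_congr (Equiv.ofBijective (fun q : Quotient t =>
    (⟨F (Function.surjInv hL q.out), Set.mem_range_self _⟩ : Set.range F)) ⟨?_, ?_⟩)).symm
  · intro q q' hq
    have := (h _ _).1 (congrArg Subtype.val hq)
    rw [Function.surjInv_eq hL, Function.surjInv_eq hL] at this
    rw [← q.out_eq, ← q'.out_eq]
    exact Quotient.sound this
  · rintro ⟨_, a, rfl⟩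
    refine ⟨Quotient.mk t (L a), Subtype.ext ((h _ _).2 ?_)⟩
    rw [Function.surjInv_eq hL]
    exact Quotient.mk_out (L a)

section Burnside

variable {Γ K V : Type*} [Group Γ] [Field K] [AddCommGroup V] [Module K V]
  [FiniteDimensional K V] [DistribMulAction Γ V] [SMulCommClass K Γ V] [SMulCommClass Γ K V]

/-- A group element fixes as many vectors as linear forms, because the endomorphism `g - 1` and its
transpose have the same rank. -/
theorem card_fixedBy_dual (g : Γ) :
    Nat.card (MulAction.fixedBy (V →ₗ[K] K) (DomMulAct.mk g)) =
      Nat.card (MulAction.fixedBy V g) := by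
  set T : V →ₗ[K] V := DistribSMul.toLinearMap K V g - LinearMap.id with hT
  have h1 : (MulAction.fixedBy V g) = (LinearMap.ker T : Set V) := by
    ext v; simp [hT, MulAction.mem_fixedBy, sub_eq_zero]
  have h2 : (MulAction.fixedBy (V →ₗ[K] K) (DomMulAct.mk g)) =
      (LinearMap.ker T.dualMap : Set (Module.Dual K V)) := by
    ext f
    simp only [MulAction.mem_fixedBy, SetLike.mem_coe, LinearMap.mem_ker]
    rw [LinearMap.ext_iff, LinearMap.ext_iff]
    simp [hT, sub_eq_zero]
  rw [h1, h2]
  have e1 := LinearMap.finrank_range_add_finrank_ker T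
  have e2 := LinearMap.finrank_range_add_finrank_ker T.dualMap
  rw [LinearMap.finrank_range_dualMap_eq_finrank_range, Subspace.dual_finrank_eq] at e2
  have e3 : Module.finrank K (LinearMap.ker T.dualMap) = Module.finrank K (LinearMap.ker T) := by
    omega
  have c1 := Module.natCard_eq_pow_finrank (K := K) (V := LinearMap.ker T)
  have c2 := Module.natCard_eq_pow_finrank (K := K) (V := LinearMap.ker T.dualMap)
  rw [e3, ← c1] at c2
  exact c2

/-- A finite group acting linearly on a finite vector space has as many orbits on vectors as on
linear forms. -/
theorem card_orbits_dual [Finite Γ] [Finite K] :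
    Nat.card (MulAction.orbitRel.Quotient Γᵈᵐᵃ (V →ₗ[K] K)) =
      Nat.card (MulAction.orbitRel.Quotient Γ V) := by
  have : Finite V := Module.finite_of_finite K
  have : Finite (V →ₗ[K] K) := Module.finite_of_finite K
  have : Finite Γᵈᵐᵃ := Finite.of_equiv Γ DomMulAct.mk
  have e1 := Nat.card_congr (MulAction.sigmaFixedByEquivOrbitsProdGroup Γ V)
  have e2 := Nat.card_congr (MulAction.sigmaFixedByEquivOrbitsProdGroup Γᵈᵐᵃ (V →ₗ[K] K))
  have e3 : Nat.card (Σ g : Γ, MulAction.fixedBy V g) =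
      Nat.card (Σ g : Γᵈᵐᵃ, MulAction.fixedBy (V →ₗ[K] K) g) :=
    Nat.card_congr (Equiv.sigmaCongr DomMulAct.mk fun g =>
      Classical.choice (Finite.card_eq.1 (card_fixedBy_dual g).symm))
  rw [Nat.card_prod] at e1 e2
  rw [← Nat.card_congr (DomMulAct.mk (M := Γ))] at e2
  exact Nat.eq_of_mul_eq_mul_right (Nat.card_pos (α := Γ))
    (e2.symm.trans (e3.symm.trans e1))

end Burnside

/-! ### Antipodal involutions and double covers -/

/-- An involution `σ` of the vertex set is antipodal if the neighbourhoods of `v` and `σ v` are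
complementary, for every vertex `v`. -/
structure SimpleGraph.IsAntipodal {V : Type*} (G : SimpleGraph V) (σ : V → V) : Prop where
  involutive : Function.Involutive σ
  adj_apply_left : ∀ v w, G.Adj (σ v) w ↔ ¬ G.Adj v w

namespace SimpleGraph

variable {V W : Type*} {G : SimpleGraph V} {H : SimpleGraph W}

theorem IsAntipodal.adj_apply_right {σ : V → V} (h : G.IsAntipodal σ) (v w : V) :
    G.Adj v (σ w) ↔ ¬ G.Adj v w := by
  rw [G.adj_comm, h.adj_apply_left, G.adj_comm]

theorem IsAntipodal.conj {τ : W → W} (h : H.IsAntipodal τ) (e : G ≃g H) :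
    G.IsAntipodal (e.symm ∘ τ ∘ e) where
  involutive v := by simp [h.involutive (e v)]
  adj_apply_left v w := by
    rw [← e.map_adj_iff, ← e.map_adj_iff]
    simp [h.adj_apply_left]

/-- Any two antipodal involutions of a graph are conjugate under its automorphism group. Both send
`v` to vertices with the same neighbourhood, so `τ ∘ σ` permutes twins; applying it only to the
vertices not adjacent to a base vertex, which form one half of each pair of complementary
twin classes, turns `σ` into `τ`. -/
theorem IsAntipodal.exists_iso_conj {σ τ : V → V} (hσ : G.IsAntipodal σ) (hτ : G.IsAntipodal τ) :
    ∃ φ : G ≃g G, ∀ v, φ (σ v) = τ (φ v) := by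
  classical
  rcases isEmpty_or_nonempty V with hV | ⟨⟨x⟩⟩
  · exact ⟨Iso.refl, fun v => hV.elim v⟩
  refine ⟨⟨⟨fun v => if G.Adj v x then v else τ (σ v), fun v => if G.Adj v x then v else σ (τ v),
    fun v => ?_, fun v => ?_⟩, fun {v w} => ?_⟩, fun v => ?_⟩
  · by_cases h : G.Adj v x <;>
      simp [h, hσ.adj_apply_left, hτ.adj_apply_left, hσ.involutive _, hτ.involutive _]
  · by_cases h : G.Adj v x <;>
      simp [h, hσ.adj_apply_left, hτ.adj_apply_left, hσ.involutive _, hτ.involutive _]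
  · by_cases h : G.Adj v x <;> by_cases h' : G.Adj w x <;>
      simp [h, h', hσ.adj_apply_left, hτ.adj_apply_left, hσ.adj_apply_right, hτ.adj_apply_right]
  · by_cases h : G.Adj v x <;>
      simp [h, hσ.adj_apply_left, hσ.involutive _, hτ.involutive _]

open Classical in
/-- The indicator function modulo 2 of the edge set of a graph. -/
noncomputable def edgeInd {α : Type*} (G : SimpleGraph α) (e : Sym2 α) : ZMod 2 :=
  if e ∈ G.edgeSet then 1 else 0

theorem edgeInd_diag {α : Type*} (G : SimpleGraph α) (i : α) : G.edgeInd s(i, i) = 0 := by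
  simp [edgeInd]

theorem edgeInd_eq_iff {α β : Type*} {G : SimpleGraph α} {H : SimpleGraph β} {i j : α} {k l : β} :
    G.edgeInd s(i, j) = H.edgeInd s(k, l) ↔ (G.Adj i j ↔ H.Adj k l) := by
  by_cases h : G.Adj i j <;> by_cases h' : H.Adj k l <;> simp [edgeInd, h, h']

theorem _root_.ZMod.two_eq_zero_or_one (a : ZMod 2) : a = 0 ∨ a = 1 := by
  revert a; decide

/-- The double cover of the complete graph on `α` in which the edges of `G` are parallel and the
non-edges are crossed, together with the matching joining the two lifts of each vertex. -/
def doubleCover {α : Type*} (G : SimpleGraph α) : SimpleGraph (α × ZMod 2) where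
  Adj p q := p.2 + q.2 + G.edgeInd s(p.1, q.1) = 1
  symm := ⟨fun p q h => by rw [Sym2.eq_swap, add_comm q.2]; exact h⟩
  loopless := ⟨fun p h => by
    rw [edgeInd_diag, CharTwo.add_self_eq_zero] at h
    simp at h⟩

variable {α : Type*}

theorem doubleCover_adj (G : SimpleGraph α) (p q : α × ZMod 2) :
    G.doubleCover.Adj p q ↔ p.2 + q.2 + G.edgeInd s(p.1, q.1) = 1 := Iff.rfl

theorem doubleCover_isAntipodal (G : SimpleGraph α) :
    G.doubleCover.IsAntipodal fun p => (p.1, p.2 + 1) where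
  involutive p := by
    have : (1 + 1 : ZMod 2) = 0 := by decide
    simp [add_assoc, this]
  adj_apply_left p q := by
    simp only [doubleCover_adj]
    generalize p.2 = a, q.2 = b, G.edgeInd s(p.1, q.1) = c
    revert a b c; decide

theorem doubleCover_isRainbowColoring {n : ℕ} (G : SimpleGraph (Fin n)) :
    G.doubleCover.IsRainbowColoring Prod.fst := by
  intro p j
  refine ⟨(j, 1 + p.2 + G.edgeInd s(p.1, j)), ⟨?_, rfl⟩, ?_⟩
  · simp only [doubleCover_adj]
    generalize p.2 = a, G.edgeInd s(p.1, j) = c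
    revert a c; decide
  · rintro ⟨k, b⟩ ⟨h, rfl⟩
    simp only [doubleCover_adj] at h ⊢
    congr 1
    generalize p.2 = a, G.edgeInd s(p.1, k) = c at *
    revert a b c; decide

theorem IsRainbow.of_iso {n : ℕ} (e : G ≃g H) (h : H.IsRainbow n) : G.IsRainbow n := by
  obtain ⟨c, hc⟩ := h
  refine ⟨c ∘ e, fun v i => ?_⟩
  obtain ⟨w, ⟨hw, hi⟩, hu⟩ := hc (e v) i
  refine ⟨e.symm w, ⟨?_, by simpa using hi⟩, fun u hu' => ?_⟩
  · rw [← e.map_adj_iff]; simpa using hw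
  · rw [← hu (e u) ⟨e.map_adj_iff.2 hu'.1, hu'.2⟩]; simp

/-- The double covers of `G` and `H` are isomorphic exactly when, up to a relabelling of the
vertices, `G` and `H` differ by Seidel switching on the set where `ε` is `1`. An arbitrary
isomorphism need not respect the deck involutions, but by `IsAntipodal.exists_iso_conj` it can be
corrected by an automorphism so that it does. -/
theorem nonempty_doubleCover_iso_iff [Finite α] (G H : SimpleGraph α) :
    Nonempty (G.doubleCover ≃g H.doubleCover) ↔ ∃ (g : Equiv.Perm α) (ε : α → ZMod 2),
      ∀ i j, H.edgeInd s(g i, g j) = G.edgeInd s(i, j) + (ε i + ε j) := by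
  constructor
  · rintro ⟨ψ⟩
    obtain ⟨φ, hφ⟩ := G.doubleCover_isAntipodal.exists_iso_conj (H.doubleCover_isAntipodal.conj ψ)
    let θ : G.doubleCover ≃g H.doubleCover := φ.trans ψ
    have hθ : ∀ p, θ (p.1, p.2 + 1) = ((θ p).1, (θ p).2 + 1) := fun p => by
      simp [θ, hφ]
    -- `θ` commutes with the two deck involutions, so its values on `(i, 0)` determine it.
    have hθ' : ∀ i a, θ (i, a) = ((θ (i, 0)).1, a + (θ (i, 0)).2) := fun i a => by
      rcases ZMod.two_eq_zero_or_one a with rfl | rfl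
      · simp
      · rw [add_comm, ← hθ (i, 0)]; simp
    have hinj : Function.Injective fun i => (θ (i, 0)).1 := fun i j hij => by
      have h : θ (i, 0) = θ (j, (θ (i, 0)).2 - (θ (j, 0)).2) := by
        rw [hθ' j]
        exact Prod.ext hij (by simp)
      exact congrArg Prod.fst (θ.injective h)
    refine ⟨Equiv.ofBijective _ (Finite.injective_iff_bijective.1 hinj), fun i => (θ (i, 0)).2,
      fun i j => ?_⟩
    have h := θ.map_adj_iff (v := (i, 0)) (w := (j, 0))
    simp only [doubleCover_adj] at h
    simp only [Equiv.ofBijective_apply]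
    generalize (θ (i, 0)).2 = a, (θ (j, 0)).2 = b, H.edgeInd s((θ (i, 0)).1, (θ (j, 0)).1) = c,
      G.edgeInd s(i, j) = d at *
    revert a b c d; decide
  · rintro ⟨g, ε, h⟩
    refine ⟨⟨⟨fun p => (g p.1, p.2 + ε p.1), fun p => (g.symm p.1, p.2 - ε (g.symm p.1)),
      fun p => by simp, fun p => by simp⟩, fun {p q} => ?_⟩⟩
    simp only [doubleCover_adj, Equiv.coe_fn_mk, h]
    generalize ε p.1 = a, ε q.1 = b, p.2 = c, q.2 = d, G.edgeInd s(p.1, q.1) = e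
    revert a b c d e; decide

/-- A rainbow graph on `2 * n` vertices is a double cover of the complete graph. Sending each vertex
to its neighbour of the same colour is a fixed-point-free involution, so every colour occurs at
least twice, hence exactly twice. -/
theorem IsRainbow.exists_iso_doubleCover [Finite V] {n : ℕ} (hV : Nat.card V = 2 * n)
    (h : G.IsRainbow n) : ∃ H : SimpleGraph (Fin n), Nonempty (H.doubleCover ≃g G) := by
  obtain ⟨c, hc⟩ := h
  have hex : ∀ v i, ∃ w, G.Adj v w ∧ c w = i := fun v i => (hc v i).exists
  have huniq : ∀ {v w w'}, G.Adj v w → G.Adj v w' → c w = c w' → w = w' := fun {v w w'} h h' e =>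
    (hc v (c w')).unique ⟨h, e⟩ ⟨h', rfl⟩
  choose f hf hfc using hex
  set σ : V → V := fun v => f v (c v) with hσ
  have hadj : ∀ v, G.Adj v (σ v) := fun v => hf v _
  have hcσ : ∀ v, c (σ v) = c v := fun v => hfc v _
  have hσσ : ∀ v, σ (σ v) = v := fun v => huniq (hadj _) (hadj v).symm (by rw [hcσ, hcσ])
  have hsurj : Function.Surjective c := fun i => by
    have : 0 < Nat.card V := by have := i.pos; omega
    obtain ⟨⟨v⟩, -⟩ := Nat.card_pos_iff.1 this
    exact ⟨f v i, hfc v i⟩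
  choose r hr using hsurj
  -- The representatives `r i` and their partners are `2 * n` distinct vertices, hence all of them.
  let θ : Fin n × ZMod 2 → V := fun p => if p.2 = 0 then r p.1 else σ (r p.1)
  have hcθ : ∀ p, c (θ p) = p.1 := fun p => by
    by_cases h : p.2 = 0 <;> simp [θ, h, hcσ, hr]
  have hθi : Function.Injective θ := by
    rintro ⟨i, a⟩ ⟨j, b⟩ h
    obtain rfl : i = j := by simpa [hcθ] using congrArg c h
    rcases ZMod.two_eq_zero_or_one a with rfl | rfl <;>
      rcases ZMod.two_eq_zero_or_one b with rfl | rfl <;> simp [θ] at h ⊢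
    · exact (hadj (r i)).ne h
    · exact (hadj (r i)).ne h.symm
  have hθ : Function.Bijective θ := by
    rw [Nat.bijective_iff_injective_and_card]
    exact ⟨hθi, by simp [hV, mul_comm]⟩
  have hfib : ∀ v w, c v = c w → v = w ∨ v = σ w := fun v w h => by
    obtain ⟨⟨i, a⟩, rfl⟩ := hθ.2 v
    obtain ⟨⟨j, b⟩, rfl⟩ := hθ.2 w
    obtain rfl : i = j := by simpa [hcθ] using h
    rcases ZMod.two_eq_zero_or_one a with rfl | rfl <;>
      rcases ZMod.two_eq_zero_or_one b with rfl | rfl <;> simp [θ, hσσ]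
  have hanti : G.IsAntipodal σ := by
    refine ⟨hσσ, fun v w => ⟨fun h h' => ?_, fun h => ?_⟩⟩
    · exact (hadj v).ne (huniq h'.symm h.symm (hcσ v).symm)
    · rcases hfib (f w (c v)) v (hfc w _) with e | e
      · exact absurd (e ▸ hf w (c v)).symm h
      · exact (e ▸ hf w (c v)).symm
  refine ⟨G.comap r, ⟨⟨Equiv.ofBijective θ hθ, fun {p q} => ?_⟩⟩⟩
  obtain ⟨i, a⟩ := p
  obtain ⟨j, b⟩ := q
  have hd : (1 : ZMod 2) + 1 = 0 := by decide
  by_cases hij : G.Adj (r i) (r j) <;> rcases ZMod.two_eq_zero_or_one a with rfl | rfl <;>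
    rcases ZMod.two_eq_zero_or_one b with rfl | rfl <;>
    simp [θ, doubleCover_adj, edgeInd, hij, hanti.adj_apply_left, hanti.adj_apply_right, hd]

end SimpleGraph

/-! ### Even graphs and linear forms on them -/

variable {α : Type*}

/-- The space of even graphs on `α`, encoded by their edge indicators modulo 2 on all unordered pairs:
such a function vanishes on the diagonal, and its values on the pairs containing a given vertex sum
to zero. -/
def evenSpace (α : Type*) [Fintype α] : Submodule (ZMod 2) (Sym2 α → ZMod 2) where
  carrier := {z | (∀ i, z s(i, i) = 0) ∧ ∀ i, ∑ j, z s(i, j) = 0}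
  zero_mem' := by simp
  add_mem' ha hb := by
    exact ⟨fun i => by simp [ha.1 i, hb.1 i],
      fun i => by simp [Finset.sum_add_distrib, ha.2 i, hb.2 i]⟩
  smul_mem' c z hz := by
    exact ⟨fun i => by simp [hz.1 i], fun i => by simp [← Finset.mul_sum, hz.2 i]⟩

namespace SimpleGraph

theorem edgeInd_comap {β : Type*} (H : SimpleGraph β) (g : α → β) (e : Sym2 α) :
    (H.comap g).edgeInd e = H.edgeInd (e.map g) := by
  induction e with | _ i j => exact edgeInd_eq_iff.2 Iff.rfl

theorem nonempty_iso_iff_exists_comap {β : Type*} (G : SimpleGraph α) (H : SimpleGraph β) :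
    Nonempty (G ≃g H) ↔ ∃ g : α ≃ β, G = H.comap g := by
  constructor
  · rintro ⟨e⟩
    exact ⟨e.toEquiv, by ext i j; exact e.map_adj_iff.symm⟩
  · rintro ⟨g, rfl⟩
    exact ⟨Iso.comap g H⟩

theorem exists_edgeInd_eq (z : Sym2 α → ZMod 2) :
    ∃ G : SimpleGraph α, ∀ i j, i ≠ j → G.edgeInd s(i, j) = z s(i, j) := by
  refine ⟨⟨fun i j => i ≠ j ∧ z s(i, j) = 1, ⟨fun i j h => ⟨h.1.symm, ?_⟩⟩, ⟨fun i h => h.1 rfl⟩⟩,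
    fun i j hij => ?_⟩
  · rw [Sym2.eq_swap]; exact h.2
  · rcases ZMod.two_eq_zero_or_one (z s(i, j)) with h | h <;> simp [edgeInd, hij, h]

theorem isEvenGraph_iff_edgeInd_mem [Fintype α] (G : SimpleGraph α) :
    G.IsEvenGraph ↔ G.edgeInd ∈ evenSpace α := by
  classical
  have key : ∀ i, ∑ j, G.edgeInd s(i, j) = (G.degree i : ZMod 2) := fun i => by
    simp [edgeInd, degree, neighborFinset_eq_filter]
  refine ⟨fun h => ⟨G.edgeInd_diag, fun i => ?_⟩, fun h i => ?_⟩
  · rw [key, ZMod.natCast_eq_zero_iff_even]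
    convert h i
  · have := h.2 i
    rw [key, ZMod.natCast_eq_zero_iff_even] at this
    convert this

end SimpleGraph

variable [Fintype α]

/-- Relabelling vertices acts on the space of even graphs. -/
instance : DistribMulAction (Equiv.Perm α) (evenSpace α) where
  smul g z := ⟨fun e => z.1 (e.map g.symm), fun i => by simpa using z.2.1 _, fun i => by
    have := z.2.2 (g.symm i)
    rw [← Equiv.sum_comp g.symm] at this
    simpa using this⟩
  one_smul z := Subtype.ext (funext fun e => by
    change z.1 (e.map id) = z.1 e
    simp)
  mul_smul g h z := Subtype.ext (funext fun e => by
    change z.1 (e.map (g * h).symm) = z.1 ((e.map g.symm).map h.symm)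
    rw [Sym2.map_map]; rfl)
  smul_zero g := rfl
  smul_add g z w := rfl

theorem evenSpace_smul_apply (g : Equiv.Perm α) (z : evenSpace α) (e : Sym2 α) :
    (g • z).1 e = z.1 (e.map g.symm) := rfl

instance : SMulCommClass (ZMod 2) (Equiv.Perm α) (evenSpace α) where
  smul_comm _ _ _ := rfl

instance : SMulCommClass (Equiv.Perm α) (ZMod 2) (evenSpace α) where
  smul_comm _ _ _ := rfl

namespace SimpleGraph

open Classical in
/-- The linear form on the space of even graphs that counts, modulo 2, the common edges with `G`. -/
noncomputable def edgePairing (G : SimpleGraph α) : evenSpace α →ₗ[ZMod 2] ZMod 2 where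
  toFun z := ∑ e, G.edgeInd e * z.1 e
  map_add' z w := by simp [mul_add, Finset.sum_add_distrib]
  map_smul' c z := by simp [Finset.mul_sum, mul_left_comm]

open Classical in
theorem edgePairing_apply (G : SimpleGraph α) (z : evenSpace α) :
    G.edgePairing z = ∑ e, G.edgeInd e * z.1 e := rfl

/-- Relabelling a graph precomposes its form with the relabelling action, which is the action of
`DomMulAct` on linear forms. -/
theorem edgePairing_comap (H : SimpleGraph α) (g : Equiv.Perm α) :
    (H.comap g).edgePairing = DomMulAct.mk g • H.edgePairing := by
  classical
  ext z
  rw [DomMulAct.mk_smul_linearMap_apply, edgePairing_apply, edgePairing_apply,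
    
    ← (Finite.injective_iff_bijective.1 (Sym2.map.injective g.injective)).sum_comp
      fun e => H.edgeInd e * (g • z).1 e]
  refine Finset.sum_congr rfl fun e _ => ?_
  rw [evenSpace_smul_apply, edgeInd_comap]
  induction e with | _ i j => simp

/-- Every linear form on the space of even graphs extends to all functions on unordered pairs, and is
therefore given by pairing with a function; its values on the diagonal do not matter, so the
function may be taken to be the indicator of a graph. -/
theorem edgePairing_surjective :
    Function.Surjective (edgePairing : SimpleGraph α → evenSpace α →ₗ[ZMod 2] ZMod 2) := by
  classical
  intro φ
  obtain ⟨ψ, hψ⟩ := LinearMap.exists_extend φ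
  obtain ⟨G, hG⟩ := exists_edgeInd_eq fun e => ψ fun e' => if e = e' then 1 else 0
  refine ⟨G, LinearMap.ext fun z => ?_⟩
  rw [← hψ, LinearMap.comp_apply, LinearMap.pi_apply_eq_sum_univ, edgePairing_apply]
  refine Finset.sum_congr rfl fun e _ => ?_
  induction e with | _ i j =>
  by_cases hij : i = j
  · subst hij
    have := z.2.1 i
    simp [this]
  · rw [hG i j hij, mul_comm]; rfl

/-- Double counting: a sum over ordered pairs groups into unordered pairs. -/
theorem _root_.Sym2.sum_sum_mul_eq_sum [DecidableEq α] {R : Type*} [CommRing R] (f : α → R)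
    (c z : Sym2 α → R) (hz : ∀ i, z s(i, i) = 0) (hc : ∀ i j, i ≠ j → c s(i, j) = f i + f j) :
    ∑ i, ∑ j, f i * z s(i, j) = ∑ e, c e * z e := by
  rw [← Fintype.sum_prod_type' (f := fun i j => f i * z s(i, j)),
    ← Finset.sum_fiberwise (g := fun p : α × α => s(p.1, p.2))]
  refine Finset.sum_congr rfl fun e _ => ?_
  induction e with | _ i j =>
  by_cases hij : i = j
  · subst hij
    rw [hz, mul_zero]
    refine Finset.sum_eq_zero fun p hp => ?_
    rw [(Finset.mem_filter.1 hp).2, hz, mul_zero]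
  · have : Finset.univ.filter (fun p : α × α => s(p.1, p.2) = s(i, j)) = {(i, j), (j, i)} := by
      ext ⟨k, l⟩; simp
    rw [this, Finset.sum_pair (by simp [hij]), hc i j hij, Sym2.eq_swap (a := j), add_mul]

/-- The form `edgePairing` determines a graph up to switching. If two graphs induce the same form
then they meet every triangle in the same number of edges modulo 2, so their difference is
determined by its edges at one vertex. -/
theorem edgePairing_eq_iff (G H : SimpleGraph α) :
    G.edgePairing = H.edgePairing ↔
      ∃ ε : α → ZMod 2, ∀ i j, G.edgeInd s(i, j) = H.edgeInd s(i, j) + (ε i + ε j) := by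
  classical
  constructor
  · intro h
    rcases isEmpty_or_nonempty α with hα | ⟨⟨x⟩⟩
    · exact ⟨0, fun i => hα.elim i⟩
    let d : Sym2 α → ZMod 2 := fun e => G.edgeInd e + H.edgeInd e
    have hd0 : ∀ i, d s(i, i) = 0 := fun i => by simp [d, edgeInd_diag]
    have hd : ∀ z : evenSpace α, ∑ e, d e * z.1 e = 0 := fun z => by
      have := LinearMap.congr_fun h z
      rw [edgePairing_apply, edgePairing_apply] at this
      simp only [d, add_mul, Finset.sum_add_distrib, this, CharTwo.add_self_eq_zero]
    -- The switching set consists of the vertices whose pair with `x` lies in exactly one graph.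
    refine ⟨fun i => d s(x, i), fun i j => ?_⟩
    have key : d s(i, j) = d s(x, i) + d s(x, j) := by
      by_cases hij : i = j
      · subst hij; rw [hd0, CharTwo.add_self_eq_zero]
      by_cases hi : x = i
      · subst hi; rw [hd0, zero_add]
      by_cases hj : x = j
      · subst hj; rw [hd0, add_zero, Sym2.eq_swap]
      have hsum : ∀ k l, k ≠ l → ∀ v,
          ∑ w, (Pi.single s(k, l) 1 : Sym2 α → ZMod 2) s(v, w) =
            (if v = k then 1 else 0) + (if v = l then 1 else 0) := fun k l hkl v => by
        simp only [Pi.single_apply, Sym2.eq_iff]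
        by_cases h1 : v = k
        · subst h1; simp [hkl]
        · by_cases h2 : v = l
          · subst h2; simp [h1]
          · simp [h1, h2]
      -- The triangle on `x`, `i`, `j` is an even graph.
      let z : evenSpace α := ⟨Pi.single s(i, j) 1 + Pi.single s(x, i) 1 + Pi.single s(x, j) 1,
        fun v => by
          simp only [Pi.add_apply, Pi.single_apply, Sym2.eq_iff]
          rw [if_neg, if_neg, if_neg] <;> grind, fun v => by
          simp only [Pi.add_apply, Finset.sum_add_distrib]
          rw [hsum i j hij, hsum x i hi, hsum x j hj]
          generalize (if v = i then (1 : ZMod 2) else 0) = a,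
            (if v = j then (1 : ZMod 2) else 0) = b, (if v = x then (1 : ZMod 2) else 0) = c
          revert a b c; decide⟩
      have := hd z
      simp only [z, Pi.add_apply, mul_add, Finset.sum_add_distrib, Pi.single_apply, mul_ite,
        mul_one, mul_zero, Finset.sum_ite_eq', Finset.mem_univ, if_true] at this
      generalize d s(i, j) = a, d s(x, i) = b, d s(x, j) = c at *
      revert a b c; decide
    rw [← key]
    simp only [d]
    generalize G.edgeInd s(i, j) = a, H.edgeInd s(i, j) = b
    revert a b; decide
  · rintro ⟨ε, h⟩
    ext z
    rw [edgePairing_apply, edgePairing_apply, ← sub_eq_zero, ← Finset.sum_sub_distrib]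
    simp only [← sub_mul]
    rw [← Sym2.sum_sum_mul_eq_sum ε (fun e => G.edgeInd e - H.edgeInd e) z.1 z.2.1
      fun i j _ => by rw [h, add_sub_cancel_left]]
    exact Finset.sum_eq_zero fun i _ => by rw [← Finset.mul_sum, z.2.2, mul_zero]

theorem nonempty_doubleCover_iso_iff_orbitRel (G H : SimpleGraph α) :
    Nonempty (G.doubleCover ≃g H.doubleCover) ↔
      MulAction.orbitRel (Equiv.Perm α)ᵈᵐᵃ (evenSpace α →ₗ[ZMod 2] ZMod 2)
        G.edgePairing H.edgePairing := by
  rw [nonempty_doubleCover_iso_iff, MulAction.orbitRel_apply, MulAction.mem_orbit_iff,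
    DomMulAct.mk.surjective.exists]
  refine exists_congr fun g => ?_
  rw [← edgePairing_comap, edgePairing_eq_iff]
  simp [edgeInd_comap]

theorem nonempty_iso_iff_orbitRel {G H : SimpleGraph α} (hG : G.edgeInd ∈ evenSpace α)
    (hH : H.edgeInd ∈ evenSpace α) :
    Nonempty (G ≃g H) ↔ MulAction.orbitRel (Equiv.Perm α) (evenSpace α)
        ⟨G.edgeInd, hG⟩ ⟨H.edgeInd, hH⟩ := by
  rw [nonempty_iso_iff_exists_comap, MulAction.orbitRel_apply, MulAction.mem_orbit_iff]
  refine (Equiv.inv (Equiv.Perm α)).exists_congr fun g => ?_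
  rw [Subtype.ext_iff, funext_iff]
  have hg : ∀ e, (g⁻¹ • (⟨H.edgeInd, hH⟩ : evenSpace α)).1 e = (H.comap g).edgeInd e := fun e => by
    rw [edgeInd_comap]; rfl
  simp only [Equiv.inv_apply, hg]
  refine ⟨fun h e => by rw [← h], fun h => ?_⟩
  ext i j
  exact (edgeInd_eq_iff.1 (h s(i, j))).symm

end SimpleGraph

/-! ### Unlabelled graphs -/

theorem UnlabelledGraph.mk_eq_mk_iff {m : ℕ} {G H : SimpleGraph (Fin m)} :
    UnlabelledGraph.mk G = UnlabelledGraph.mk H ↔ Nonempty (G ≃g H) :=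
  Quotient.eq

theorem ncard_unlabelled_isRainbow (n : ℕ) :
    {X : UnlabelledGraph (2 * n) | ∃ G : SimpleGraph (Fin (2 * n)),
        G.IsRainbow n ∧ UnlabelledGraph.mk G = X}.ncard =
      Nat.card (MulAction.orbitRel.Quotient (Equiv.Perm (Fin n))ᵈᵐᵃ
        (evenSpace (Fin n) →ₗ[ZMod 2] ZMod 2)) := by
  let e : Fin (2 * n) ≃ Fin n × ZMod 2 := Fintype.equivOfCardEq (by simp [mul_comm])
  let D : SimpleGraph (Fin n) → SimpleGraph (Fin (2 * n)) := fun G => G.doubleCover.comap e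
  let iso : ∀ G, D G ≃g G.doubleCover := fun G => SimpleGraph.Iso.comap e _
  rw [show {X : UnlabelledGraph (2 * n) | ∃ G : SimpleGraph (Fin (2 * n)),
        G.IsRainbow n ∧ UnlabelledGraph.mk G = X} =
      Set.range fun G => UnlabelledGraph.mk (D G) from ?_]
  · refine Set.ncard_range_eq_card_quotient _ _ SimpleGraph.edgePairing_surjective fun G H => ?_
    rw [UnlabelledGraph.mk_eq_mk_iff, ← SimpleGraph.nonempty_doubleCover_iso_iff_orbitRel]
    exact ⟨fun ⟨f⟩ => ⟨((iso G).symm.trans f).trans (iso H)⟩,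
      fun ⟨f⟩ => ⟨((iso G).trans f).trans (iso H).symm⟩⟩
  · ext X
    constructor
    · rintro ⟨G, hG, rfl⟩
      obtain ⟨H, ⟨f⟩⟩ := hG.exists_iso_doubleCover (by simp)
      exact ⟨H, UnlabelledGraph.mk_eq_mk_iff.2 ⟨(iso H).trans f⟩⟩
    · rintro ⟨G, rfl⟩
      exact ⟨D G, .of_iso (iso G) ⟨_, G.doubleCover_isRainbowColoring⟩, rfl⟩

theorem ncard_unlabelled_isEvenGraph (n : ℕ) :
    {X : UnlabelledGraph n | ∃ G : SimpleGraph (Fin n),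
        G.IsEvenGraph ∧ UnlabelledGraph.mk G = X}.ncard =
      Nat.card (MulAction.orbitRel.Quotient (Equiv.Perm (Fin n)) (evenSpace (Fin n))) := by
  rw [show {X : UnlabelledGraph n | ∃ G : SimpleGraph (Fin n),
        G.IsEvenGraph ∧ UnlabelledGraph.mk G = X} =
      Set.range fun G : {G : SimpleGraph (Fin n) // G.edgeInd ∈ evenSpace (Fin n)} =>
        UnlabelledGraph.mk G.1 from ?_]
  · refine Set.ncard_range_eq_card_quotient _ (fun G => ⟨G.1.edgeInd, G.2⟩) (fun z => ?_)
      fun G H => ?_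
    · obtain ⟨G, hG⟩ := SimpleGraph.exists_edgeInd_eq z.1
      have : G.edgeInd = z.1 := funext fun e => by
        induction e with | _ i j =>
        by_cases hij : i = j
        · subst hij; rw [G.edgeInd_diag, z.2.1]
        · exact hG i j hij
      exact ⟨⟨G, this ▸ z.2⟩, Subtype.ext this⟩
    · rw [UnlabelledGraph.mk_eq_mk_iff]
      exact SimpleGraph.nonempty_iso_iff_orbitRel G.2 H.2
  · ext X
    simp [SimpleGraph.isEvenGraph_iff_edgeInd_mem]

theorem mainTheorem3 (n : ℕ) :
    {X : UnlabelledGraph (2 * n) | ∃ G : SimpleGraph (Fin (2 * n)),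
        G.IsRainbow n ∧ UnlabelledGraph.mk G = X}.ncard =
      {X : UnlabelledGraph n | ∃ G : SimpleGraph (Fin n),
        G.IsEvenGraph ∧ UnlabelledGraph.mk G = X}.ncard := by
  rw [ncard_unlabelled_isRainbow, ncard_unlabelled_isEvenGraph, card_orbits_dual]
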